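/- Let $k$ be a field. A linear category is an abelian category compatibly enriched over $k$-vector spaces (with linear functors the $k$-linear additive ones); it is finite if it has finite-dimensional morphism spaces, every object has finite length, it has enough projectives, and it has finitely many isomorphism classes of simple objects. A finite tensor category is a finite linear category with a monoidal structure whose tensor product is $k$-linear in each variable and in which every object has a left and a right dual. A left module category over a finite tensor category $\mathcal C$ is a linear category $\mathcal M$ with a functor $\otimes:\mathcal C\times\mathcal M\to\mathcal M$ that is $k$-linear in each variable and natural isomorphisms $(c\otimes c')\otimes m\cong c\otimes(c'\otimes m)$ and $1\otimes m\cong m$ satisfying the pentagon and triangle identities. Theorem. Let $\mathcal C$ be a finite tensor category over $k$ and let $\mathcal M$ be a left $\mathcal C$-module category that is finite as a linear category. Assume that the action is right exact in $\mathcal C$, that is, for every object $m$ of $\mathcal M$ the functor $c\mapsto c\otimes m$ from $\mathcal C$ to $\mathcal M$ is right exact. Then there exist an algebra object (monoid object) $A$ in $\mathcal C$ and an equivalence $\mathcal M\simeq \mathrm{Mod}_A(\mathcal C)$ of left $\mathcal C$-module categories. Here $\mathrm{Mod}_A(\mathcal C)$ is the category of right $A$-module objects in $\mathcal C$, where $c\in\mathcal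 C$ acts by sending $X$ to $c\otimes X$ with $A$ acting through $X$. An equivalence of left $\mathcal C$-module categories consists of an equivalence of categories, both of whose functors are linear and carry natural isomorphisms $F(c\otimes m)\cong c\otimes F(m)$ compatible with the associativity and unit isomorphisms, and whose unit and counit are compatible with these isomorphisms. -/

import Mathlib

open CategoryTheory MonoidalCategory
open scoped MonObj MonoidalLeftAction

universe w v₁ v₂ v₃ u₁ u₂ u₃

/-- A `k`-linear category `C` (that is, an abelian category enriched over `k`-vector spaces) is
*finite* if it has finite-dimensional morphism spaces, every object has finite length (every
strictly decreasing chain of subobjects is finite), there are enough projectives, and there are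
finitely many isomorphism classes of simple objects.  (In the presence of the other three
conditions, the descending chain condition implies the ascending one.) -/
class IsFiniteLinearCategory (k : Type w) [Field k] (C : Type u₁) [Category.{v₁} C] [Abelian C]
    [Linear k C] : Prop where
  finite_hom : ∀ X Y : C, Module.Finite k (X ⟶ Y)
  finite_length : ∀ X : C, IsArtinianObject X
  enough_projectives : EnoughProjectives C
  finite_simples : ∃ s : Set C, s.Finite ∧ ∀ S : C, Simple S → ∃ T ∈ s, Nonempty (S ≅ T)

/-- The action functor `C × M ⥤ M` is `k`-linear in each variable separately. -/
class IsBilinearAction (k : Type w) [Field k] (C : Type u₁) [Category.{v₁} C] [MonoidalCategory C]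
    [Preadditive C] [Linear k C] (M : Type u₂) [Category.{v₂} M] [Preadditive M] [Linear k M]
    [MonoidalLeftAction C M] : Prop where
  add_actionHomLeft : ∀ {c c' : C} (f g : c ⟶ c') (m : M), (f + g) ⊵ₗ m = f ⊵ₗ m + g ⊵ₗ m
  smul_actionHomLeft : ∀ (r : k) {c c' : C} (f : c ⟶ c') (m : M), (r • f) ⊵ₗ m = r • f ⊵ₗ m
  actionHomRight_add : ∀ (c : C) {m m' : M} (f g : m ⟶ m'), c ⊴ₗ (f + g) = c ⊴ₗ f + c ⊴ₗ g
  actionHomRight_smul : ∀ (r : k) (c : C) {m m' : M} (f : m ⟶ m'), c ⊴ₗ (r • f) = r • c ⊴ₗ f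

/-- The action of `C` on `M` is right exact in `C`: for every `m : M` the functor
`c ↦ c ⊙ₗ m` from `C` to `M` is right exact. -/
def ActionRightExactLeft (C : Type u₁) [Category.{v₁} C] [MonoidalCategory C]
    (M : Type u₂) [Category.{v₂} M] [MonoidalLeftAction C M] : Prop :=
  ∀ m : M, Limits.PreservesFiniteColimits ((MonoidalLeftAction.curriedAction C M).flip.obj m)

/-- An equivalence of left `C`-module categories: an equivalence in the 2-category of left
`C`-module categories, (strong) `C`-module functors and `C`-module transformations.
The last two fields say that the unit `𝟭 ⟶ G ∘ F` and the counit `F ∘ G ⟶ 𝟭` are `C`-module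
transformations, where a composite of module functors has the composite structure map. -/
structure LeftModuleEquivalence (k : Type w) [Field k] (C : Type u₁) [Category.{v₁} C]
    [MonoidalCategory C] (M : Type u₂) [Category.{v₂} M] [Preadditive M] [Linear k M]
    [MonoidalLeftAction C M] (N : Type u₃) [Category.{v₃} N] [Preadditive N] [Linear k N]
    [MonoidalLeftAction C N] where
  toEquivalence : M ≌ N
  functor_additive : toEquivalence.functor.Additive
  functor_linear : toEquivalence.functor.Linear k
  inverse_additive : toEquivalence.inverse.Additive
  inverse_linear : toEquivalence.inverse.Linear k
  functor_leftLinear : toEquivalence.functor.LeftLinear C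
  inverse_leftLinear : toEquivalence.inverse.LeftLinear C
  unit_module : ∀ (c : C) (m : M),
    c ⊴ₗ toEquivalence.unit.app m =
      toEquivalence.unit.app (c ⊙ₗ m) ≫
        toEquivalence.inverse.map
          (Functor.OplaxLeftLinear.δₗ toEquivalence.functor c m) ≫
        Functor.OplaxLeftLinear.δₗ toEquivalence.inverse c (toEquivalence.functor.obj m)
  counit_module : ∀ (c : C) (n : N),
    toEquivalence.functor.map (Functor.OplaxLeftLinear.δₗ toEquivalence.inverse c n) ≫
        Functor.OplaxLeftLinear.δₗ toEquivalence.functor c (toEquivalence.inverse.obj n) ≫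
        c ⊴ₗ toEquivalence.counit.app n =
      toEquivalence.counit.app (c ⊙ₗ n)

/-- A right module object over an algebra (monoid) object `A` of a monoidal category. -/
structure RightModObj {C : Type u₁} [Category.{v₁} C] [MonoidalCategory C] (A : C) [MonObj A] where
  X : C
  act : X ⊗ A ⟶ X
  act_one : X ◁ η[A] ≫ act = (ρ_ X).hom
  act_mul : X ◁ μ[A] ≫ act = (α_ X A A).inv ≫ act ▷ A ≫ act

namespace RightModObj

section

variable {C : Type u₁} [Category.{v₁} C] [MonoidalCategory C] {A : C} [MonObj A]

/-- Morphisms of right `A`-modules. -/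
@[ext]
structure Hom (P Q : RightModObj A) where
  hom : P.X ⟶ Q.X
  comm : P.act ≫ hom = hom ▷ A ≫ Q.act

instance : Category (RightModObj A) where
  Hom P Q := Hom P Q
  id P := ⟨𝟙 P.X, by simp⟩
  comp f g := ⟨f.hom ≫ g.hom, by
    rw [← Category.assoc, f.comm, Category.assoc, g.comm, comp_whiskerRight, Category.assoc]⟩

@[ext]
theorem hom_ext {P Q : RightModObj A} {f g : P ⟶ Q} (h : f.hom = g.hom) : f = g := Hom.ext h

theorem hom_injective (P Q : RightModObj A) :
    Function.Injective (fun f : P ⟶ Q => (f.hom : P.X ⟶ Q.X)) := fun _ _ h => hom_ext h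

@[simp]
theorem id_hom (P : RightModObj A) : (𝟙 P : P ⟶ P).hom = 𝟙 P.X := rfl

@[simp]
theorem comp_hom {P Q R : RightModObj A} (f : P ⟶ Q) (g : Q ⟶ R) :
    (f ≫ g).hom = f.hom ≫ g.hom := rfl

/-- Isomorphisms of right modules from isomorphisms of the underlying objects. -/
def mkIso {P Q : RightModObj A} (e : P.X ≅ Q.X) (h : P.act ≫ e.hom = e.hom ▷ A ≫ Q.act) :
    P ≅ Q where
  hom := ⟨e.hom, h⟩
  inv := ⟨e.inv, by
    rw [Iso.comp_inv_eq, Category.assoc, h, ← Category.assoc, ← comp_whiskerRight]; simp⟩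
  hom_inv_id := by ext; exact e.hom_inv_id
  inv_hom_id := by ext; exact e.inv_hom_id

@[simp]
theorem mkIso_hom_hom {P Q : RightModObj A} (e : P.X ≅ Q.X)
    (h : P.act ≫ e.hom = e.hom ▷ A ≫ Q.act) : (mkIso e h).hom.hom = e.hom := rfl

@[simp]
theorem mkIso_inv_hom {P Q : RightModObj A} (e : P.X ≅ Q.X)
    (h : P.act ≫ e.hom = e.hom ▷ A ≫ Q.act) : (mkIso e h).inv.hom = e.inv := rfl

/-- The right `A`-module `c ⊗ P`, on which `A` acts through `P`. -/
def tensorObj (c : C) (P : RightModObj A) : RightModObj A where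
  X := c ⊗ P.X
  act := (α_ c P.X A).hom ≫ c ◁ P.act
  act_one := by
    rw [associator_naturality_right_assoc, ← whiskerLeft_comp, P.act_one]
    simp
  act_mul := by
    rw [associator_naturality_right_assoc, ← whiskerLeft_comp, P.act_mul]
    simp

/-- The category of right `A`-modules in `C` is a left `C`-module category. -/
instance : MonoidalLeftAction C (RightModObj A) where
  actionObj c P := tensorObj c P
  actionHomLeft {c c'} f P := ⟨f ▷ P.X, by simp [tensorObj, whisker_exchange]⟩
  actionHomRight c {P Q} g := ⟨c ◁ g.hom, by
    simp [tensorObj, ← whiskerLeft_comp, g.comm]⟩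
  actionHom {c c' P Q} f g := ⟨f ⊗ₘ g.hom, by
    have h := g.comm
    have e : (f ⊗ₘ g.hom) ▷ A = (α_ c P.X A).hom ≫ (f ⊗ₘ (g.hom ▷ A)) ≫ (α_ c' Q.X A).inv := by
      simp [MonoidalCategory.tensorHom_def]
    simp only [tensorObj, e, Category.assoc, Iso.inv_hom_id_assoc]
    rw [← id_tensorHom, ← id_tensorHom, tensorHom_comp_tensorHom, tensorHom_comp_tensorHom, h]
    simp⟩
  actionAssocIso c c' P := mkIso (α_ c c' P.X) (by simp [tensorObj])
  actionUnitIso P := mkIso (λ_ P.X) (by simp [tensorObj])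
  actionHom_def f g := by ext; exact MonoidalCategory.tensorHom_def _ _
  actionHomRight_id c P := by ext; exact whiskerLeft_id _ _
  id_actionHomLeft c P := by ext; exact id_whiskerRight _ _
  actionHom_comp f₁ f₂ g₁ g₂ := by ext; exact (tensorHom_comp_tensorHom _ _ _ _).symm
  actionAssocIso_hom_naturality f g h := by ext; exact associator_naturality _ _ _
  actionUnitIso_hom_naturality f := by ext; exact (leftUnitor_naturality _).symm
  whiskerLeft_actionHomLeft c _ _ f P := by ext; exact whisker_assoc _ _ _
  whiskerRight_actionHomLeft c'' f P := by ext; exact whiskerRight_tensor_symm _ _ _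
  associator_actionHom c₁ c₂ c₃ P := by ext; exact pentagon _ _ _ _
  leftUnitor_actionHom c P := by ext; exact leftUnitor_whiskerRight _ _
  rightUnitor_actionHom c P := by ext; exact (triangle _ _).symm

end

section

variable {C : Type u₁} [Category.{v₁} C] [MonoidalCategory C] {A : C} [MonObj A]
  [Preadditive C] [MonoidalPreadditive C]

instance (P Q : RightModObj A) : Zero (P ⟶ Q) := ⟨⟨0, by simp⟩⟩
instance (P Q : RightModObj A) : Add (P ⟶ Q) :=
  ⟨fun f g => ⟨f.hom + g.hom, by simp [f.comm, g.comm]⟩⟩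
instance (P Q : RightModObj A) : Neg (P ⟶ Q) := ⟨fun f => ⟨-f.hom, by
    have h : (-f.hom) ▷ A = -(f.hom ▷ A) := (tensorRight A).map_neg
    simp [f.comm, h]⟩⟩
instance (P Q : RightModObj A) : Sub (P ⟶ Q) :=
  ⟨fun f g => ⟨f.hom - g.hom, by
    have h : (f.hom - g.hom) ▷ A = f.hom ▷ A - g.hom ▷ A := (tensorRight A).map_sub
    simp [f.comm, g.comm, h]⟩⟩
instance (P Q : RightModObj A) : SMul ℕ (P ⟶ Q) :=
  ⟨fun n f => ⟨n • f.hom, by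
    have h : (n • f.hom) ▷ A = n • (f.hom ▷ A) := (tensorRight A).map_nsmul
    simp [f.comm, h]⟩⟩
instance (P Q : RightModObj A) : SMul ℤ (P ⟶ Q) :=
  ⟨fun n f => ⟨n • f.hom, by
    have h : (n • f.hom) ▷ A = n • (f.hom ▷ A) := (tensorRight A).map_zsmul
    simp [f.comm, h]⟩⟩

instance (P Q : RightModObj A) : AddCommGroup (P ⟶ Q) :=
  (hom_injective P Q).addCommGroup _ rfl (fun _ _ => rfl) (fun _ => rfl) (fun _ _ => rfl)
    (fun _ _ => rfl) (fun _ _ => rfl)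

/-- Addition of morphisms of right modules is addition of the underlying morphisms. -/
instance : Preadditive (RightModObj A) where
  add_comp P Q R f f' g := by ext; exact Preadditive.add_comp _ _ _ _ _ _
  comp_add P Q R f g g' := by ext; exact Preadditive.comp_add _ _ _ _ _ _

@[simp]
theorem add_hom {P Q : RightModObj A} (f g : P ⟶ Q) : (f + g).hom = f.hom + g.hom := rfl

variable {k : Type w} [Field k] [Linear k C] [MonoidalLinear k C]

instance (P Q : RightModObj A) : SMul k (P ⟶ Q) :=
  ⟨fun r f => ⟨r • f.hom, by simp [f.comm]⟩⟩

/-- Scalar multiplication of morphisms of right modules is that of the underlying morphisms. -/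
instance : Linear k (RightModObj A) where
  homModule P Q := (hom_injective P Q).module k
    { toFun := fun f : P ⟶ Q => f.hom
      map_zero' := rfl
      map_add' := fun _ _ => rfl } (fun _ _ => rfl)
  smul_comp P Q R r f g := by ext; exact Linear.smul_comp _ _ _ _ _ _
  comp_smul P Q R f r g := by ext; exact Linear.comp_smul _ _ _ _ _ _

instance : IsBilinearAction k C (RightModObj A) where
  add_actionHomLeft f g P := by ext; exact MonoidalPreadditive.add_whiskerRight _ _
  smul_actionHomLeft r _ _ f P := by ext; exact MonoidalLinear.smul_whiskerRight _ _ _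
  actionHomRight_add c _ _ f g := by ext; exact MonoidalPreadditive.whiskerLeft_add _ _
  actionHomRight_smul r c _ _ f := by ext; exact MonoidalLinear.whiskerLeft_smul _ _ _

end

end RightModObj

/-! Choose a projective `m` in `M` that maps nontrivially to every nonzero object. The right exact
functor `c ↦ c ⊙ₗ m` has a right adjoint `U`, the internal Hom out of `m`, and `A = U m` is the
algebra of internal endomorphisms.

The adjoint exists for dimension reasons (`isLeftAdjoint_of_preservesFiniteColimits`). It is exact
because acting on a projective gives a projective (`projective_actionObj`), and faithful because `m`
detects zero objects. Duals make the lax structure `c ⊗ U n ⟶ U (c ⊙ₗ n)` invertible (`isIso_lin`),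
so the monad `U (- ⊙ₗ m)` becomes `- ⊗ A` and its algebras become right `A`-modules. Exactness and
faithfulness of `U` then give monadicity by a direct abelian argument (`exists_iso_obj`,
`full_toModules`), and `lin` makes the comparison functor a module functor. -/

namespace CategoryTheory

open Limits

/-! ### Projective objects that detect zero objects. -/

section Generator

variable {C : Type u₁} [Category.{v₁} C] [Abelian C]

/-- An object `P` of an abelian category detects zero objects if every object that receives only
zero morphisms from `P` is zero. -/
def DetectsZero (P : C) : Prop :=
  ∀ X : C, (∀ f : P ⟶ X, f = 0) → IsZero X

/-- Every map from `P` to the image of `f` lifts to `X` by projectivity, so it vanishes; hence the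
image is zero. -/
theorem DetectsZero.eq_zero {P : C} [Projective P] (hP : DetectsZero P) {X Y : C} (f : X ⟶ Y)
    (h : ∀ g : P ⟶ X, g ≫ f = 0) : f = 0 := by
  have hz : IsZero (Abelian.image f) := by
    refine hP _ fun g => ?_
    have e := h (Projective.factorThru g (Abelian.factorThruImage f))
    have e' : g ≫ Abelian.image.ι f = 0 := by
      rw [← e, ← Projective.factorThru_comp g (Abelian.factorThruImage f), Category.assoc,
        Abelian.image.fac]
      simp
    exact zero_of_comp_mono _ e'
  rw [← Abelian.image.fac f, hz.eq_of_tgt (Abelian.factorThruImage f) 0, zero_comp]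

theorem DetectsZero.mono {P : C} [Projective P] (hP : DetectsZero P) {X Y : C} (f : X ⟶ Y)
    (h : ∀ g : P ⟶ X, g ≫ f = 0 → g = 0) : Mono f :=
  Preadditive.mono_of_cancel_zero _ fun {Z} g hg =>
    hP.eq_zero g fun t => h _ (by rw [Category.assoc, hg, comp_zero])

theorem DetectsZero.epi {P : C} [Projective P] (hP : DetectsZero P) {X Y : C} (f : X ⟶ Y)
    (h : ∀ g : P ⟶ Y, ∃ t : P ⟶ X, t ≫ f = g) : Epi f :=
  Preadditive.epi_of_cancel_zero _ fun {Z} g hg =>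
    hP.eq_zero g fun t => by
      obtain ⟨s, rfl⟩ := h t
      rw [Category.assoc, hg, comp_zero]

/-- Take the sum of projectives covering representatives of the simple objects. A nonzero object has
a simple subobject by the descending chain condition, and the sum maps onto it. -/
theorem exists_projective_detectsZero (k : Type w) [Field k] (C : Type u₁) [Category.{v₁} C]
    [Abelian C] [Linear k C] [IsFiniteLinearCategory k C] :
    ∃ P : C, Projective P ∧ DetectsZero P := by
  obtain ⟨s, hs, h⟩ := IsFiniteLinearCategory.finite_simples k (C := C)
  have := IsFiniteLinearCategory.enough_projectives k (C := C)
  have := hs.to_subtype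
  have := Abelian.hasFiniteBiproducts (C := C)
  let Q : s → C := fun T => Projective.over T.1
  refine ⟨⨁ Q, ⟨fun {E X} f e _ => ?_⟩, fun X hX => ?_⟩
  · refine ⟨biproduct.desc fun T => Projective.factorThru (biproduct.ι Q T ≫ f) e, ?_⟩
    ext T
    simp
  · by_contra hz
    have := IsFiniteLinearCategory.finite_length k X
    obtain ⟨T, hT, ⟨e⟩⟩ := h (simpleSubobject hz) inferInstance
    have h0 := hX (biproduct.π Q ⟨T, hT⟩ ≫ Projective.π T ≫ e.inv ≫ simpleSubobjectArrow hz)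
    have h1 : biproduct.π Q ⟨T, hT⟩ ≫ Projective.π T = 0 := by
      rw [← Category.assoc, ← Category.assoc] at h0
      have h2 := zero_of_comp_mono _ h0
      rwa [Preadditive.IsIso.comp_right_eq_zero] at h2
    have h3 : Projective.π T = 0 := zero_of_epi_comp _ h1
    have h4 : IsZero T := by
      rw [IsZero.iff_id_eq_zero, ← cancel_epi (Projective.π T), h3, zero_comp, zero_comp]
    exact Simple.not_isZero (simpleSubobject hz) (h4.of_iso e)

end Generator

/-! ### Right adjoints from dimension bounds. -/

section RightAdjoint

variable {k : Type w} [Field k] {C : Type u₁} [Category.{v₁} C] [Abelian C] [Linear k C]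
  {D : Type u₂} [Category.{v₂} D] [Preadditive D]

/-- A morphism `x : L c ⟶ d` is reduced, relative to `P`, if no nonzero morphism `P ⟶ c` is
killed by it. -/
def IsReduced (P : C) (L : C ⥤ D) {c : C} {d : D} (x : L.obj c ⟶ d) : Prop :=
  ∀ f : P ⟶ c, L.map f ≫ x = 0 → f = 0

/-- Reducedness says that `f ↦ L.map f ≫ x` is injective. The resulting bound does not depend on
`c`, so a reduced pair of maximal dimension exists. -/
theorem IsReduced.finrank_le [Linear k D] {P : C} {L : C ⥤ D} [L.Additive] [L.Linear k] {c : C} {d : D}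
    {x : L.obj c ⟶ d} (hx : IsReduced P L x) [Module.Finite k (L.obj P ⟶ d)] :
    Module.finrank k (P ⟶ c) ≤ Module.finrank k (L.obj P ⟶ d) := by
  let φ : (P ⟶ c) →ₗ[k] (L.obj P ⟶ d) := Linear.rightComp k (L.obj P) x ∘ₗ L.mapLinearMap k
  refine LinearMap.finrank_le_finrank_of_injective (f := φ) ?_
  rw [← LinearMap.ker_eq_bot, LinearMap.ker_eq_bot']
  exact fun f hf => hx f hf

/-- If `x` kills a nonzero `f : P ⟶ c`, right exactness factors it through `L (cokernel f)`. Since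
`P` is projective, `Hom(P, c)` surjects onto `Hom(P, cokernel f)` with `f` in the kernel, so the
dimension drops and the process stops. -/
theorem exists_isReduced_factor {P : C} [Projective P] (hfin : ∀ X : C, Module.Finite k (P ⟶ X))
    (L : C ⥤ D) [L.Additive] [PreservesFiniteColimits L] {d : D} {c : C} (x : L.obj c ⟶ d) :
    ∃ (c' : C) (q : c ⟶ c') (x' : L.obj c' ⟶ d), L.map q ≫ x' = x ∧ IsReduced P L x' := by
  obtain ⟨n, hn⟩ : ∃ n, Module.finrank k (P ⟶ c) = n := ⟨_, rfl⟩
  induction n using Nat.strong_induction_on generalizing c with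
  | _ n ih =>
  by_cases hx : IsReduced P L x
  · exact ⟨c, 𝟙 c, x, by simp, hx⟩
  · simp only [IsReduced, not_forall] at hx
    obtain ⟨f, hf, hf0⟩ := hx
    have hcol := isColimitCoforkMapOfIsColimit' L (cokernel.condition f) (cokernelIsCokernel f)
    let y : L.obj (cokernel f) ⟶ d := hcol.desc (CokernelCofork.ofπ x (by simpa using hf))
    have hy : L.map (cokernel.π f) ≫ y = x :=
      hcol.fac (CokernelCofork.ofπ x (by simpa using hf)) WalkingParallelPair.one
    have hlt : Module.finrank k (P ⟶ cokernel f) < n := by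
      have := hfin c
      have := hfin (cokernel f)
      let φ : (P ⟶ c) →ₗ[k] (P ⟶ cokernel f) := Linear.rightComp k P (cokernel.π f)
      have hφ : Function.Surjective φ := fun g =>
        ⟨Projective.factorThru g (cokernel.π f), Projective.factorThru_comp _ _⟩
      have h1 := φ.finrank_range_add_finrank_ker
      rw [LinearMap.range_eq_top.2 hφ, finrank_top] at h1
      have : 0 < Module.finrank k (LinearMap.ker φ) := by
        have hfk : f ∈ LinearMap.ker φ := cokernel.condition f
        have : Nontrivial (LinearMap.ker φ) :=
          ⟨⟨f, hfk⟩, 0, fun h => hf0 (congrArg Subtype.val h)⟩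
        exact Module.finrank_pos
      omega
    obtain ⟨c', q, x', h1, h2⟩ := ih _ hlt y rfl
    exact ⟨c', cokernel.π f ≫ q, x', by rw [L.map_comp, Category.assoc, h1, hy], h2⟩

/-- A right exact linear functor out of an abelian category with a projective object that detects
zero objects has a right adjoint, provided that the relevant morphism spaces are
finite-dimensional. -/
theorem isLeftAdjoint_of_preservesFiniteColimits [Linear k D] {P : C} [Projective P] (hP : DetectsZero P)
    (hC : ∀ X : C, Module.Finite k (P ⟶ X)) (hD : ∀ X Y : D, Module.Finite k (X ⟶ Y))
    (L : C ⥤ D) [L.Additive] [L.Linear k] [PreservesFiniteColimits L] : L.IsLeftAdjoint := by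
  rw [isLeftAdjoint_iff_hasTerminal_costructuredArrow]
  intro d
  -- A reduced pair `(c, x)` with `Hom(P, c)` of maximal dimension will be terminal over `d`.
  let S : Set ℕ := {n | ∃ (c : C) (x : L.obj c ⟶ d), IsReduced P L x ∧
    Module.finrank k (P ⟶ c) = n}
  have hS : BddAbove S := by
    refine ⟨Module.finrank k (L.obj P ⟶ d), ?_⟩
    rintro n ⟨c, x, hx, rfl⟩
    have := hD (L.obj P) d
    exact hx.finrank_le
  have hne : S.Nonempty := by
    obtain ⟨c', -, x', -, hx'⟩ := exists_isReduced_factor (k := k) hC L (0 : L.obj P ⟶ d)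
    exact ⟨_, c', x', hx', rfl⟩
  obtain ⟨c, x, hx, hmax⟩ := Nat.sSup_mem hne hS
  have huniq : ∀ {b : C} (f g : b ⟶ c), L.map f ≫ x = L.map g ≫ x → f = g := by
    intro b f g h
    rw [← sub_eq_zero]
    refine hP.eq_zero _ fun t => hx _ ?_
    rw [L.map_comp, L.map_sub, Category.assoc, Preadditive.sub_comp, h, sub_self, comp_zero]
  have hex : ∀ {b : C} (y : L.obj b ⟶ d), ∃ f : b ⟶ c, L.map f ≫ x = y := by
    intro b y
    -- Merge `x` and `y` and reduce. The map `p : c ⟶ e` is mono because `x` is reduced and epi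
    -- because `(c, x)` has maximal dimension; inverting it turns `b ⟶ e` into the required `b ⟶ c`.
    let s : L.obj (c ⊞ b) ⟶ d := L.map biprod.fst ≫ x + L.map biprod.snd ≫ y
    obtain ⟨e, q, z, hz, hzr⟩ := exists_isReduced_factor (k := k) hC L s
    have h1 : L.map (biprod.inl ≫ q) ≫ z = x := by
      rw [L.map_comp, Category.assoc, hz]
      simp [s, ← L.map_comp_assoc]
    have h2 : L.map (biprod.inr ≫ q) ≫ z = y := by
      rw [L.map_comp, Category.assoc, hz]
      simp [s, ← L.map_comp_assoc]
    set p : c ⟶ e := biprod.inl ≫ q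
    have hp : ∀ g : P ⟶ c, g ≫ p = 0 → g = 0 := fun g hg => hx g (by
      rw [← h1, ← L.map_comp_assoc, hg, L.map_zero, zero_comp])
    have := hP.mono p hp
    have : Epi p := by
      refine hP.epi p ?_
      have := hC c
      have := hC e
      let φ : (P ⟶ c) →ₗ[k] (P ⟶ e) := Linear.rightComp k P p
      have hφ : Function.Injective φ := by
        rw [← LinearMap.ker_eq_bot, LinearMap.ker_eq_bot']
        exact hp
      have hle : Module.finrank k (P ⟶ e) ≤ Module.finrank k (P ⟶ c) := by
        rw [hmax]
        exact le_csSup hS ⟨e, z, hzr, rfl⟩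
      exact (LinearMap.injective_iff_surjective_of_finrank_eq_finrank
        (le_antisymm (LinearMap.finrank_le_finrank_of_injective hφ) hle)).1 hφ
    have : IsIso p := isIso_of_mono_of_epi p
    exact ⟨(biprod.inr ≫ q) ≫ inv p, by
      rw [← h2, L.map_comp, Category.assoc, ← h1, ← L.map_comp_assoc (inv p)]; simp⟩
  choose lift hlift using @hex
  refine IsTerminal.hasTerminal (X := CostructuredArrow.mk x) (IsTerminal.ofUniqueHom
    (fun Y => CostructuredArrow.homMk (lift Y.hom) (hlift Y.hom)) fun Y g => ?_)
  ext
  apply huniq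
  exact (CostructuredArrow.w g).trans (hlift Y.hom).symm

end RightAdjoint

end CategoryTheory

/-! ### Duality and adjunctions between action functors. -/

namespace CategoryTheory.MonoidalCategory.MonoidalLeftAction

variable {C : Type u₁} [Category.{v₁} C] [MonoidalCategory C]
  {M : Type u₂} [Category.{v₂} M] [MonoidalLeftAction C M]

/-- The morphism `d ⟶ c ⊙ₗ (c' ⊙ₗ d)` induced by the coevaluation of an exact pairing. -/
def coevaluationAction (c c' : C) [ExactPairing c c'] (d : M) : d ⟶ c ⊙ₗ c' ⊙ₗ d :=
  (λₗ d).inv ≫ (η_ c c') ⊵ₗ d ≫ (αₗ c c' d).hom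

/-- The morphism `c' ⊙ₗ (c ⊙ₗ d) ⟶ d` induced by the evaluation of an exact pairing. -/
def evaluationAction (c c' : C) [ExactPairing c c'] (d : M) : c' ⊙ₗ c ⊙ₗ d ⟶ d :=
  (αₗ c' c d).inv ≫ (ε_ c c') ⊵ₗ d ≫ (λₗ d).hom

theorem coevaluationAction_naturality (c c' : C) [ExactPairing c c'] {d d' : M} (f : d ⟶ d') :
    f ≫ coevaluationAction c c' d' = coevaluationAction c c' d ≫ c ⊴ₗ c' ⊴ₗ f := by
  simp only [coevaluationAction, Category.assoc]
  rw [← actionUnitIso_inv_naturality_assoc, action_exchange_assoc]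
  simp

theorem evaluationAction_naturality (c c' : C) [ExactPairing c c'] {d d' : M} (f : d ⟶ d') :
    c' ⊴ₗ c ⊴ₗ f ≫ evaluationAction c c' d' = evaluationAction c c' d ≫ f := by
  simp only [evaluationAction, Category.assoc]
  rw [actionUnitIso_hom_naturality, ← action_exchange_assoc]
  simp

theorem associator_hom_comp_actionHomRight_inv (c₁ c₂ c₃ : C) (d : M) :
    (αₗ (c₁ ⊗ c₂) c₃ d).hom ≫ (αₗ c₁ c₂ (c₃ ⊙ₗ d)).hom ≫ c₁ ⊴ₗ (αₗ c₂ c₃ d).inv =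
      (α_ c₁ c₂ c₃).hom ⊵ₗ d ≫ (αₗ c₁ (c₂ ⊗ c₃) d).hom := by
  rw [← associator_actionHom_assoc, actionHomRight_hom_inv, Category.comp_id]

theorem actionHomRight_hom_comp_associator_inv (c₁ c₂ c₃ : C) (d : M) :
    c₁ ⊴ₗ (αₗ c₂ c₃ d).hom ≫ (αₗ c₁ c₂ (c₃ ⊙ₗ d)).inv ≫ (αₗ (c₁ ⊗ c₂) c₃ d).inv =
      (αₗ c₁ (c₂ ⊗ c₃) d).inv ≫ (α_ c₁ c₂ c₃).inv ⊵ₗ d := by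
  rw [← cancel_epi ((α_ c₁ c₂ c₃).hom ⊵ₗ d ≫ (αₗ c₁ (c₂ ⊗ c₃) d).hom)]
  simp

/-- This is a zigzag identity of the pairing acting on `d`, rewritten through the coherence of the
action. -/
theorem coevaluationAction_evaluationAction (c c' : C) [ExactPairing c c'] (d : M) :
    coevaluationAction c c' (c ⊙ₗ d) ≫ c ⊴ₗ evaluationAction c c' d = 𝟙 (c ⊙ₗ d) := by
  have h : (λ_ c).inv ⊵ₗ d ≫ (η_ c c' ▷ c ≫ (α_ _ _ _).hom ≫ c ◁ ε_ c c') ⊵ₗ d ≫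
      (ρ_ c).hom ⊵ₗ d = 𝟙 _ := by
    rw [ExactPairing.evaluation_coevaluation, ← comp_actionHomLeft, ← comp_actionHomLeft]
    simp
  rw [← h]
  have hl : (λ_ c).inv ⊵ₗ d = (λₗ (c ⊙ₗ d)).inv ≫ (αₗ (𝟙_ C) c d).inv := by
    rw [← cancel_mono ((λ_ c).hom ⊵ₗ d), inv_hom_actionHomLeft]
    simp
  have ha := associator_hom_comp_actionHomRight_inv c c' c d
  rw [hl, comp_actionHomLeft, comp_actionHomLeft, whiskerLeft_actionHomLeft]
  simp only [Category.assoc]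
  rw [← reassoc_of% ha]
  simp [coevaluationAction, evaluationAction]

theorem coevaluationAction_evaluationAction' (c c' : C) [ExactPairing c c'] (d : M) :
    c' ⊴ₗ coevaluationAction c c' d ≫ evaluationAction c c' (c' ⊙ₗ d) = 𝟙 (c' ⊙ₗ d) := by
  have h : (ρ_ c').inv ⊵ₗ d ≫ (c' ◁ η_ c c' ≫ (α_ _ _ _).inv ≫ ε_ c c' ▷ c') ⊵ₗ d ≫
      (λ_ c').hom ⊵ₗ d = 𝟙 _ := by
    rw [ExactPairing.coevaluation_evaluation, ← comp_actionHomLeft, ← comp_actionHomLeft]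
    simp
  rw [← h]
  have hr : (ρ_ c').inv ⊵ₗ d = c' ⊴ₗ (λₗ d).inv ≫ (αₗ c' (𝟙_ C) d).inv := by
    rw [← cancel_mono ((ρ_ c').hom ⊵ₗ d), inv_hom_actionHomLeft]
    simp
  have ha := actionHomRight_hom_comp_associator_inv c' c c' d
  rw [hr, comp_actionHomLeft, comp_actionHomLeft, whiskerLeft_actionHomLeft]
  simp only [Category.assoc]
  rw [← reassoc_of% ha]
  simp [coevaluationAction, evaluationAction]

variable (M) in
/-- The functors of acting by the two objects of an exact pairing are adjoint. -/
def actionLeftAdjunction (c c' : C) [ExactPairing c c'] : actionLeft M c' ⊣ actionLeft M c :=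
  Adjunction.mkOfUnitCounit
    { unit := { app := fun d => coevaluationAction c c' d
                naturality := fun _ _ f => coevaluationAction_naturality c c' f }
      counit := { app := fun d => evaluationAction c c' d
                  naturality := fun _ _ f => evaluationAction_naturality c c' f }
      left_triangle := by
        ext d
        refine (congrArg _ (Category.id_comp _)).trans ?_
        exact coevaluationAction_evaluationAction' c c' d
      right_triangle := by
        ext d
        refine (congrArg _ (Category.id_comp _)).trans ?_
        exact coevaluationAction_evaluationAction c c' d }

/-- The right adjoint of acting by `c` is acting by its left dual. That is itself a left adjoint, by
the double dual, so it preserves epimorphisms, and its left adjoint preserves projectives. -/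
theorem projective_actionObj [RigidCategory C] (c : C) (m : M) [Projective m] :
    Projective (c ⊙ₗ m) := by
  have := (actionLeftAdjunction M (ᘁ(ᘁc : C) : C) (ᘁc : C)).isLeftAdjoint
  exact (actionLeftAdjunction M (ᘁc : C) c).map_projective m inferInstance

end CategoryTheory.MonoidalCategory.MonoidalLeftAction

namespace CategoryTheory.MonoidalCategory

open MonoidalLeftAction Limits

/-! ### Internal Homs of a module category -/

namespace InternalHom

variable {C : Type u₁} [Category.{v₁} C] [MonoidalCategory C]
  {M : Type u₂} [Category.{v₂} M] [MonoidalLeftAction C M]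
  {m : M} {U : M ⥤ C} (adj : actionRight C m ⊣ U)

/-- The evaluation morphism of the internal Hom. -/
def ev (n : M) : U.obj n ⊙ₗ m ⟶ n := adj.counit.app n

/-- The morphism to the internal Hom corresponding to a morphism out of an action. -/
def curry {c : C} {n : M} (f : c ⊙ₗ m ⟶ n) : c ⟶ U.obj n := adj.homEquiv c n f

@[simp]
theorem curry_ev {c : C} {n : M} (f : c ⊙ₗ m ⟶ n) : curry adj f ⊵ₗ m ≫ ev adj n = f := by
  have h := (adj.homEquiv c n).symm_apply_apply f
  rwa [Adjunction.homEquiv_counit] at h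

@[simp]
theorem curry_ev_assoc {c : C} {n n' : M} (f : c ⊙ₗ m ⟶ n) (g : n ⟶ n') :
    curry adj f ⊵ₗ m ≫ ev adj n ≫ g = f ≫ g := by
  rw [reassoc_of% (curry_ev adj f)]

theorem hom_ext {c : C} {n : M} {f g : c ⟶ U.obj n}
    (h : f ⊵ₗ m ≫ ev adj n = g ⊵ₗ m ≫ ev adj n) : f = g := by
  apply (adj.homEquiv c n).symm.injective
  rwa [Adjunction.homEquiv_counit, Adjunction.homEquiv_counit]

@[simp]
theorem map_ev {n n' : M} (f : n ⟶ n') : U.map f ⊵ₗ m ≫ ev adj n' = ev adj n ≫ f :=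
  adj.counit.naturality f

@[simp]
theorem map_ev_assoc {n n' x : M} (f : n ⟶ n') (g : n' ⟶ x) :
    U.map f ⊵ₗ m ≫ ev adj n' ≫ g = ev adj n ≫ f ≫ g := by
  rw [reassoc_of% (map_ev adj f)]

/-- The structure morphism of the internal Hom as a lax module functor. -/
def lin (c : C) (n : M) : c ⊗ U.obj n ⟶ U.obj (c ⊙ₗ n) :=
  curry adj ((αₗ c (U.obj n) m).hom ≫ c ⊴ₗ ev adj n)

@[simp]
theorem lin_ev (c : C) (n : M) :
    lin adj c n ⊵ₗ m ≫ ev adj (c ⊙ₗ n) = (αₗ c (U.obj n) m).hom ≫ c ⊴ₗ ev adj n :=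
  curry_ev adj _

@[simp]
theorem lin_ev_assoc (c : C) {n n' : M} (g : c ⊙ₗ n ⟶ n') :
    lin adj c n ⊵ₗ m ≫ ev adj (c ⊙ₗ n) ≫ g =
      (αₗ c (U.obj n) m).hom ≫ c ⊴ₗ ev adj n ≫ g := by
  rw [reassoc_of% (lin_ev adj c n)]

theorem lin_naturality_left {c c' : C} (f : c ⟶ c') (n : M) :
    f ▷ U.obj n ≫ lin adj c' n = lin adj c n ≫ U.map (f ⊵ₗ n) := by
  apply hom_ext adj
  simp only [comp_actionHomLeft, Category.assoc, lin_ev, map_ev, lin_ev_assoc,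
    whiskerRight_actionHomLeft, Iso.inv_hom_id_assoc, action_exchange]

theorem lin_naturality_left_assoc {c c' x : C} (f : c ⟶ c') (n : M)
    (g : U.obj (c' ⊙ₗ n) ⟶ x) :
    f ▷ U.obj n ≫ lin adj c' n ≫ g = lin adj c n ≫ U.map (f ⊵ₗ n) ≫ g := by
  rw [reassoc_of% (lin_naturality_left adj f n)]

theorem lin_naturality_right (c : C) {n n' : M} (f : n ⟶ n') :
    c ◁ U.map f ≫ lin adj c n' = lin adj c n ≫ U.map (c ⊴ₗ f) := by
  apply hom_ext adj
  simp only [comp_actionHomLeft, Category.assoc, lin_ev, map_ev, lin_ev_assoc,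
    whiskerLeft_actionHomLeft, Iso.inv_hom_id_assoc, ← actionHomRight_comp]

theorem lin_associativity (c c' : C) (n : M) :
    lin adj (c ⊗ c') n ≫ U.map (αₗ c c' n).hom =
      (α_ c c' (U.obj n)).hom ≫ c ◁ lin adj c' n ≫ lin adj c (c' ⊙ₗ n) := by
  apply hom_ext adj
  simp only [comp_actionHomLeft, Category.assoc, lin_ev, map_ev, lin_ev_assoc,
    whiskerLeft_actionHomLeft, Iso.inv_hom_id_assoc, tensor_actionHomRight, Iso.inv_hom_id,
    Category.comp_id]
  rw [← actionHomRight_comp, lin_ev, actionHomRight_comp, associator_actionHom_assoc]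

theorem lin_associativity_assoc (c c' : C) (n : M) {x : C}
    (g : U.obj (c ⊙ₗ c' ⊙ₗ n) ⟶ x) :
    lin adj (c ⊗ c') n ≫ U.map (αₗ c c' n).hom ≫ g =
      (α_ c c' (U.obj n)).hom ≫ c ◁ lin adj c' n ≫ lin adj c (c' ⊙ₗ n) ≫ g := by
  rw [reassoc_of% (lin_associativity adj c c' n)]

theorem lin_unitality (n : M) :
    lin adj (𝟙_ C) n ≫ U.map (λₗ n).hom = (λ_ (U.obj n)).hom := by
  apply hom_ext adj
  simp

/-- Associativity, naturality and unitality of `lin` carry evaluation in `M` to evaluation in `C`;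
this and `coevaluation_lin` are the two inputs for inverting `lin`. -/
theorem lin_evaluationAction (c c' : C) [ExactPairing c c'] (n : M) :
    c' ◁ lin adj c n ≫ lin adj c' (c ⊙ₗ n) ≫ U.map (evaluationAction c c' n) =
      (α_ c' c (U.obj n)).inv ≫ ε_ c c' ▷ U.obj n ≫ (λ_ (U.obj n)).hom := by
  rw [← cancel_epi (α_ c' c (U.obj n)).hom, ← lin_associativity_assoc, Iso.hom_inv_id_assoc,
    ← lin_unitality adj n, lin_naturality_left_assoc, ← U.map_comp, ← U.map_comp,
    evaluationAction, Iso.hom_inv_id_assoc]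

theorem coevaluation_lin (c c' : C) [ExactPairing c c'] (n : M) :
    (λ_ (U.obj n)).inv ≫ η_ c c' ▷ U.obj n ≫ (α_ c c' (U.obj n)).hom ≫ c ◁ lin adj c' n ≫
      lin adj c (c' ⊙ₗ n) = U.map (coevaluationAction c c' n) := by
  rw [← lin_associativity, lin_naturality_left_assoc, Iso.inv_comp_eq, ← lin_unitality adj n,
    Category.assoc, ← U.map_comp, ← U.map_comp, coevaluationAction, Iso.hom_inv_id_assoc]

/-- A lax module functor over a rigid category is strong: the inverse inserts `c ⊗ cᘁ`, applies
`lin` for the dual `cᘁ`, and evaluates inside `U`. -/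
theorem isIso_lin [RigidCategory C] (c : C) (n : M) : IsIso (lin adj c n) := by
  refine ⟨(λ_ _).inv ≫ η_ c (cᘁ) ▷ _ ≫ (α_ _ _ _).hom ≫ c ◁ lin adj (cᘁ) (c ⊙ₗ n) ≫
    c ◁ U.map (evaluationAction c (cᘁ) n), ?_, ?_⟩
  · have h1 : lin adj c n ≫ (λ_ _).inv ≫ η_ c (cᘁ) ▷ _ ≫ (α_ _ _ _).hom =
        (λ_ _).inv ≫ η_ c (cᘁ) ▷ _ ≫ (α_ _ _ _).hom ≫ c ◁ (cᘁ) ◁ lin adj c n := by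
      rw [leftUnitor_inv_naturality_assoc, whisker_exchange_assoc]
      simp
    -- Here the zigzag identity is used for `C` acting on itself.
    have h2 := coevaluationAction_evaluationAction c (cᘁ) (U.obj n)
    rw [reassoc_of% h1, ← whiskerLeft_comp, ← whiskerLeft_comp, lin_evaluationAction]
    refine Eq.trans ?_ h2
    simp [coevaluationAction, evaluationAction]
  · have h := coevaluation_lin adj c (cᘁ) (c ⊙ₗ n)
    simp only [Category.assoc]
    rw [lin_naturality_right, reassoc_of% h, ← U.map_comp, coevaluationAction_evaluationAction,
      U.map_id]

/-! ### The algebra of internal endomorphisms and its modules -/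

/-- The right action of the internal endomorphisms on an internal Hom. -/
def act (n : M) : U.obj n ⊗ U.obj m ⟶ U.obj n := lin adj (U.obj n) m ≫ U.map (ev adj n)

@[simp]
theorem act_ev (n : M) : act adj n ⊵ₗ m ≫ ev adj n =
    (αₗ (U.obj n) (U.obj m) m).hom ≫ U.obj n ⊴ₗ ev adj m ≫ ev adj n := by
  simp [act]

@[simp]
theorem act_ev_assoc {n n' : M} (g : n ⟶ n') : act adj n ⊵ₗ m ≫ ev adj n ≫ g =
    (αₗ (U.obj n) (U.obj m) m).hom ≫ U.obj n ⊴ₗ ev adj m ≫ ev adj n ≫ g := by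
  rw [reassoc_of% (act_ev adj n)]

/-- The unit of the algebra of internal endomorphisms. -/
def one : 𝟙_ C ⟶ U.obj m := curry adj (λₗ m).hom

@[simp]
theorem one_ev : one adj ⊵ₗ m ≫ ev adj m = (λₗ m).hom := curry_ev adj _

theorem act_one (n : M) : U.obj n ◁ one adj ≫ act adj n = (ρ_ (U.obj n)).hom := by
  apply hom_ext adj
  simp only [comp_actionHomLeft, Category.assoc, act_ev, whiskerLeft_actionHomLeft,
    Iso.inv_hom_id_assoc, rightUnitor_actionHom]
  rw [← actionHomRight_comp_assoc, one_ev]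

/-- Through `lin`, the unit of the adjunction becomes tensoring with the unit of the algebra. -/
theorem curry_id (c : C) :
    curry adj (𝟙 (c ⊙ₗ m)) = (ρ_ c).inv ≫ c ◁ one adj ≫ lin adj c m := by
  apply hom_ext adj
  rw [curry_ev]
  simp only [comp_actionHomLeft, Category.assoc, lin_ev, whiskerLeft_actionHomLeft,
    Iso.inv_hom_id_assoc]
  rw [← actionHomRight_comp, one_ev, ← rightUnitor_actionHom, inv_hom_actionHomLeft]

/-- Both sides are iterated evaluation after transposition. The case `n = m` is associativity of the
algebra; general `n` gives the module axiom. -/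
theorem act_act (n : M) : U.obj n ◁ act adj m ≫ act adj n =
    (α_ (U.obj n) (U.obj m) (U.obj m)).inv ≫ act adj n ▷ U.obj m ≫ act adj n := by
  rw [← cancel_epi (α_ (U.obj n) (U.obj m) (U.obj m)).hom, Iso.hom_inv_id_assoc]
  apply hom_ext adj
  simp only [comp_actionHomLeft, Category.assoc, act_ev, whiskerLeft_actionHomLeft,
    Iso.inv_hom_id_assoc, whiskerRight_actionHomLeft]
  rw [← action_exchange_assoc, act_ev, ← actionHomRight_comp_assoc, act_ev, tensor_actionHomRight]
  simp only [actionHomRight_comp, Category.assoc, associator_actionHom_assoc,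
    Iso.inv_hom_id_assoc]

theorem one_act : one adj ▷ U.obj m ≫ act adj m = (λ_ (U.obj m)).hom := by
  apply hom_ext adj
  simp only [comp_actionHomLeft, Category.assoc, act_ev, whiskerRight_actionHomLeft,
    Iso.inv_hom_id_assoc]
  rw [← action_exchange_assoc, one_ev, ← actionUnitIso_hom_naturality]
  simp

theorem lin_act (c : C) (n : M) : lin adj c n ▷ U.obj m ≫ act adj (c ⊙ₗ n) =
    (α_ c (U.obj n) (U.obj m)).hom ≫ c ◁ act adj n ≫ lin adj c n := by
  apply hom_ext adj
  simp only [comp_actionHomLeft, Category.assoc, act_ev, lin_ev, whiskerLeft_actionHomLeft,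
    Iso.inv_hom_id_assoc, whiskerRight_actionHomLeft]
  rw [← action_exchange_assoc, lin_ev, ← actionHomRight_comp, act_ev, tensor_actionHomRight]
  simp only [actionHomRight_comp, Category.assoc, associator_actionHom_assoc,
    Iso.inv_hom_id_assoc]

theorem act_naturality {n n' : M} (f : n ⟶ n') :
    act adj n ≫ U.map f = U.map f ▷ U.obj m ≫ act adj n' := by
  apply hom_ext adj
  simp only [comp_actionHomLeft, Category.assoc, act_ev, map_ev, act_ev_assoc,
    whiskerRight_actionHomLeft, Iso.inv_hom_id_assoc]
  rw [← action_exchange_assoc, map_ev]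

/-- The algebra of internal endomorphisms of an object of a module category. -/
@[reducible]
def monObj : MonObj (U.obj m) where
  one := one adj
  mul := act adj m
  one_mul := one_act adj
  mul_one := act_one adj m
  mul_assoc := by rw [act_act, Iso.hom_inv_id_assoc]

/-- The functor from a module category to modules over an algebra of internal endomorphisms. -/
def toModules :
    letI := monObj adj
    M ⥤ RightModObj (U.obj m) :=
  letI := monObj adj
  { obj := fun n => ⟨U.obj n, act adj n, act_one adj n, act_act adj n⟩
    map := fun f => ⟨U.map f, act_naturality adj f⟩
    map_id := fun n => RightModObj.hom_ext (U.map_id n)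
    map_comp := fun f g => RightModObj.hom_ext (U.map_comp f g) }

/-- An algebra over the monad of the internal Hom adjunction comes from an object of the module
category, provided that the internal Hom is right exact. -/
theorem exists_iso_obj [Abelian C] [Abelian M] [(actionRight C m).Additive] [U.Additive]
    [PreservesFiniteColimits U] {X : C} (b : U.obj (X ⊙ₗ m) ⟶ X) (h1 : curry adj (𝟙 (X ⊙ₗ m)) ≫ b = 𝟙 X)
    (h2 : U.map (ev adj (X ⊙ₗ m)) ≫ b = U.map (b ⊵ₗ m) ≫ b) :
    ∃ (n : M) (e : U.obj n ≅ X), U.map (e.hom ⊵ₗ m) ≫ b = U.map (ev adj n) ≫ e.hom := by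
  -- `h1` and `h2` are the axioms of an algebra over the monad. The object sought is the quotient of
  -- `X ⊙ₗ m` by the image of `κ'`, the transpose of the kernel of `b`; the maps `U.map π` and `b`
  -- then turn out to be the same quotient of `U (X ⊙ₗ m)`.
  have : IsSplitEpi b := ⟨⟨⟨_, h1⟩⟩⟩
  let κ := kernel.ι b
  let κ' : kernel b ⊙ₗ m ⟶ X ⊙ₗ m := κ ⊵ₗ m ≫ ev adj (X ⊙ₗ m)
  let π := cokernel.π κ'
  have hκ : κ = curry adj (𝟙 (kernel b ⊙ₗ m)) ≫ U.map κ' := by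
    apply hom_ext adj
    simp [κ']
  have hκπ : κ ≫ U.map π = 0 := by
    rw [hκ, Category.assoc, ← U.map_comp, cokernel.condition, U.map_zero, comp_zero]
  have hκb : U.map κ' ≫ b = 0 := by
    have h0 : (κ ≫ b) ⊵ₗ m = 0 := by
      rw [kernel.condition]
      exact (actionRight C m).map_zero _ _
    rw [U.map_comp, Category.assoc, h2, ← U.map_comp_assoc, ← comp_actionHomLeft, h0, U.map_zero,
      zero_comp]
  -- Right exactness makes `U.map π` a cokernel of `U.map κ'`, so `hκb` gives `ψ`; since `b` is a
  -- cokernel of `κ`, `hκπ` gives `θ` in the other direction.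
  have hcol := isColimitCoforkMapOfIsColimit' U (cokernel.condition κ') (cokernelIsCokernel κ')
  obtain ⟨ψ, hψ⟩ : ∃ ψ : U.obj (cokernel κ') ⟶ X, U.map π ≫ ψ = b :=
    ⟨hcol.desc (CokernelCofork.ofπ b hκb),
      hcol.fac (CokernelCofork.ofπ b hκb) WalkingParallelPair.one⟩
  obtain ⟨θ, hθ⟩ : ∃ θ : X ⟶ U.obj (cokernel κ'), b ≫ θ = U.map π :=
    ⟨Abelian.epiDesc b _ hκπ, Abelian.comp_epiDesc b _ hκπ⟩
  have := adj.leftAdjoint_preservesColimits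
  have : Epi (U.map π ⊵ₗ m) := inferInstanceAs (Epi ((actionRight C m).map (U.map π)))
  refine ⟨cokernel κ', ⟨ψ, θ, ?_, ?_⟩, ?_⟩
  · rw [← cancel_epi (U.map π), reassoc_of% hψ, hθ, Category.comp_id]
  · rw [← cancel_epi b, reassoc_of% hθ, hψ, Category.comp_id]
  · change U.map (ψ ⊵ₗ m) ≫ b = U.map (ev adj (cokernel κ')) ≫ ψ
    rw [← cancel_epi (U.map (U.map π ⊵ₗ m)), ← U.map_comp_assoc, ← comp_actionHomLeft, hψ, ← h2,
      ← U.map_comp_assoc, map_ev, U.map_comp, Category.assoc, hψ]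

end InternalHom

end CategoryTheory.MonoidalCategory

/-! ### Right modules over the algebra as algebras over the monad. -/

namespace CategoryTheory.MonoidalCategory

open MonoidalLeftAction Limits

namespace InternalHom

variable {C : Type u₁} [Category.{v₁} C] [MonoidalCategory C] [RigidCategory C]
  {M : Type u₂} [Category.{v₂} M] [MonoidalLeftAction C M]
  {m : M} {U : M ⥤ C} (adj : actionRight C m ⊣ U)

/-- The isomorphism underlying `lin`. -/
noncomputable def linIso (c : C) (n : M) : c ⊗ U.obj n ≅ U.obj (c ⊙ₗ n) :=
  have := isIso_lin adj c n
  asIso (lin adj c n)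

theorem lin_linIso_inv_assoc {c x : C} {n : M} (g : c ⊗ U.obj n ⟶ x) :
    lin adj c n ≫ (linIso adj c n).inv ≫ g = g :=
  (linIso adj c n).hom_inv_id_assoc g

theorem linIso_inv_lin_assoc {c x : C} {n : M} (g : U.obj (c ⊙ₗ n) ⟶ x) :
    (linIso adj c n).inv ≫ lin adj c n ≫ g = g :=
  (linIso adj c n).inv_hom_id_assoc g

section

variable {X : C} (a : X ⊗ U.obj m ⟶ X)

theorem curry_id_linIso_inv (h : X ◁ one adj ≫ a = (ρ_ X).hom) :
    curry adj (𝟙 (X ⊙ₗ m)) ≫ (linIso adj X m).inv ≫ a = 𝟙 X := by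
  rw [curry_id, Category.assoc, Category.assoc, lin_linIso_inv_assoc, h, Iso.inv_hom_id]

/-- Precomposing with the isomorphisms `X ⊗ A ⊗ A ≅ U (X ⊙ₗ m) ⊗ A ≅ U (U (X ⊙ₗ m) ⊙ₗ m)` turns
monad associativity into the module axiom. -/
theorem map_ev_linIso_inv
    (h : X ◁ act adj m ≫ a = (α_ X (U.obj m) (U.obj m)).inv ≫ a ▷ U.obj m ≫ a) :
    U.map (ev adj (X ⊙ₗ m)) ≫ (linIso adj X m).inv ≫ a =
      U.map (((linIso adj X m).inv ≫ a) ⊵ₗ m) ≫ (linIso adj X m).inv ≫ a := by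
  have h1 := lin_act adj X m
  have h2 := lin_naturality_left adj ((linIso adj X m).inv ≫ a) m
  have : IsIso (lin adj X m) := isIso_lin adj _ _
  have : IsIso (lin adj (U.obj (X ⊙ₗ m)) m) := isIso_lin adj _ _
  rw [← cancel_epi (lin adj (U.obj (X ⊙ₗ m)) m), ← reassoc_of% h2,
    ← cancel_epi (lin adj X m ▷ U.obj m)]
  simp only [act] at h1 h
  rw [reassoc_of% h1, lin_linIso_inv_assoc, ← comp_whiskerRight_assoc, lin_linIso_inv_assoc, h,
    Iso.hom_inv_id_assoc]

/-- `A`-linearity and compatibility with the monad structures differ only by precomposition with the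
isomorphism `lin`. -/
theorem act_comp_iff {n : M} (g : U.obj n ⟶ X) :
    act adj n ≫ g = g ▷ U.obj m ≫ a ↔
      U.map (g ⊵ₗ m) ≫ (linIso adj X m).inv ≫ a = U.map (ev adj n) ≫ g := by
  have : IsIso (lin adj (U.obj n) m) := isIso_lin adj _ _
  rw [← cancel_epi (lin adj (U.obj n) m), ← lin_naturality_left_assoc, lin_linIso_inv_assoc, act,
    Category.assoc, eq_comm]

end

section Abelian

variable [Abelian C] [Abelian M]

/-- Faithfulness makes `ev` epi, hence a cokernel of its kernel. The transpose of a module map kills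
that kernel, which can be checked after `U`, so it descends to a morphism in `M`. -/
theorem full_toModules [U.Additive] [U.Faithful] :
    letI := monObj adj; (toModules adj).Full := by
  let := monObj adj
  refine ⟨fun {n n'} g => ?_⟩
  have hg := (act_comp_iff adj (act adj n') g.hom).1 g.comm
  rw [act, linIso_inv_lin_assoc] at hg
  obtain ⟨f, hf⟩ : ∃ f : U.obj n ⟶ U.obj n', f = g.hom := ⟨g.hom, rfl⟩
  rw [← hf] at hg
  have : Epi (ev adj n) := adj.counit_epi_of_R_faithful n
  have h0 : kernel.ι (ev adj n) ≫ f ⊵ₗ m ≫ ev adj n' = 0 := by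
    apply U.map_injective
    rw [U.map_comp, U.map_comp, hg, ← U.map_comp_assoc, kernel.condition, U.map_zero, zero_comp,
      U.map_zero]
  obtain ⟨φ, hφ⟩ : ∃ φ : n ⟶ n', ev adj n ≫ φ = f ⊵ₗ m ≫ ev adj n' :=
    ⟨Abelian.epiDesc _ _ h0, Abelian.comp_epiDesc _ _ h0⟩
  refine ⟨φ, RightModObj.hom_ext ?_⟩
  refine Eq.trans ?_ hf
  apply hom_ext adj
  exact (map_ev adj φ).trans hφ

theorem essSurj_toModules [(actionRight C m).Additive] [U.Additive] [PreservesFiniteColimits U] :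
    letI := monObj adj; (toModules adj).EssSurj := by
  let := monObj adj
  refine ⟨fun N => ?_⟩
  obtain ⟨n, e, he⟩ := exists_iso_obj adj _ (curry_id_linIso_inv adj N.act N.act_one)
    (map_ev_linIso_inv adj N.act N.act_mul)
  exact ⟨n, ⟨RightModObj.mkIso e ((act_comp_iff adj N.act e.hom).2 he)⟩⟩

/-- If the internal Hom functor is faithful and right exact, then the module category is equivalent
to the category of modules over the algebra of internal endomorphisms. -/
theorem isEquivalence_toModules [(actionRight C m).Additive] [U.Additive] [U.Faithful]
    [PreservesFiniteColimits U] :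
    letI := monObj adj; (toModules adj).IsEquivalence :=
  letI := monObj adj
  { faithful := ⟨fun h => U.map_injective (congrArg RightModObj.Hom.hom h)⟩
    full := full_toModules adj
    essSurj := essSurj_toModules adj }

end Abelian

end InternalHom

end CategoryTheory.MonoidalCategory

theorem RightModObj.isIso_of_isIso_hom {C : Type u₁} [Category.{v₁} C] [MonoidalCategory C] {A : C}
    [MonObj A] {P Q : RightModObj A} (f : P ⟶ Q) [IsIso f.hom] : IsIso f :=
  (mkIso (asIso f.hom) f.comm).isIso_hom

/-! ### Equivalences whose functor is a module functor. -/

namespace CategoryTheory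

open MonoidalLeftAction CategoryTheory.Functor

section LeftLinear

variable {C : Type u₁} [Category.{v₁} C] [MonoidalCategory C]
  {M : Type u₂} [Category.{v₂} M] [MonoidalLeftAction C M]
  {N : Type u₃} [Category.{v₃} N] [MonoidalLeftAction C N]

/-- A lax module functor whose structure morphisms are isomorphisms is a module functor. -/
@[reducible]
noncomputable def Functor.leftLinearOfIsIso (F : M ⥤ N) [F.LaxLeftLinear C]
    (h : ∀ (c : C) (m : M), IsIso (LaxLeftLinear.μₗ F c m)) : F.LeftLinear C where
  δₗ c m := CategoryTheory.inv (LaxLeftLinear.μₗ F c m)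
  δₗ_naturality_left f d := by
    rw [IsIso.comp_inv_eq, Category.assoc, IsIso.eq_inv_comp, LaxLeftLinear.μₗ_naturality_left]
  δₗ_naturality_right c _ _ f := by
    rw [IsIso.comp_inv_eq, Category.assoc, IsIso.eq_inv_comp, LaxLeftLinear.μₗ_naturality_right]
  δₗ_associativity c c' d := by
    rw [IsIso.inv_comp_eq, ← inv_actionHomRight, ← IsIso.inv_comp, ← Category.assoc,
      IsIso.eq_comp_inv, LaxLeftLinear.μₗ_associativity]
  δₗ_unitality_inv d := by
    rw [IsIso.eq_comp_inv, LaxLeftLinear.μₗ_unitality_inv]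
  μₗ_comp_δₗ c d := IsIso.hom_inv_id _
  δₗ_comp_μₗ c d := IsIso.inv_hom_id _

namespace Equivalence

variable (e : M ≌ N)

theorem hom_ext_of_map_counit {m : M} {n : N} {f g : m ⟶ e.inverse.obj n}
    (h : e.functor.map f ≫ e.counit.app n = e.functor.map g ≫ e.counit.app n) : f = g :=
  e.functor.map_injective ((cancel_mono (e.counit.app n)).1 h)

variable [e.functor.LeftLinear C]

/-- The structure morphism of the inverse of an equivalence whose functor is a module functor. -/
def inverseμₗ (c : C) (n : N) : c ⊙ₗ e.inverse.obj n ⟶ e.inverse.obj (c ⊙ₗ n) :=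
  e.unit.app _ ≫ e.inverse.map
    (OplaxLeftLinear.δₗ e.functor c (e.inverse.obj n) ≫ c ⊴ₗ e.counit.app n)

@[simp]
theorem map_inverseμₗ_counit (c : C) (n : N) :
    e.functor.map (inverseμₗ e c n) ≫ e.counit.app (c ⊙ₗ n) =
      OplaxLeftLinear.δₗ e.functor c (e.inverse.obj n) ≫ c ⊴ₗ e.counit.app n := by
  simp [inverseμₗ]

theorem map_inverseμₗ_counit_assoc (c : C) {n n' : N} (g : c ⊙ₗ n ⟶ n') :
    e.functor.map (inverseμₗ e c n) ≫ e.counit.app (c ⊙ₗ n) ≫ g =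
      OplaxLeftLinear.δₗ e.functor c (e.inverse.obj n) ≫
        actionHomRight c (d' := n) (e.counit.app n) ≫ g := by
  rw [reassoc_of% (map_inverseμₗ_counit e c n)]

theorem map_inverse_map_counit {n n' : N} (f : n ⟶ n') :
    e.functor.map (e.inverse.map f) ≫ e.counit.app n' = e.counit.app n ≫ f := by
  simp

variable (C) in
/-- The inverse of an equivalence whose functor is a module functor is a lax module functor. -/
@[reducible]
def inverseLaxLeftLinear : e.inverse.LaxLeftLinear C where
  μₗ c n := inverseμₗ e c n
  μₗ_naturality_left f n := by
    apply e.hom_ext_of_map_counit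
    simp only [Functor.map_comp, Category.assoc, map_inverse_map_counit, map_inverseμₗ_counit,
      map_inverseμₗ_counit_assoc, OplaxLeftLinear.δₗ_naturality_left_assoc, action_exchange]
  μₗ_naturality_right c _ _ f := by
    apply e.hom_ext_of_map_counit
    simp only [Functor.map_comp, Category.assoc, map_inverse_map_counit, map_inverseμₗ_counit,
      map_inverseμₗ_counit_assoc, OplaxLeftLinear.δₗ_naturality_right_assoc,
      ← actionHomRight_comp]
  μₗ_associativity c c' n := by
    apply e.hom_ext_of_map_counit
    simp only [Functor.map_comp, Category.assoc, map_inverse_map_counit, map_inverseμₗ_counit,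
      map_inverseμₗ_counit_assoc, OplaxLeftLinear.δₗ_naturality_right_assoc,
      ← actionHomRight_comp]
    simp only [actionHomRight_comp, tensor_actionHomRight, Category.assoc, Iso.inv_hom_id,
      Category.comp_id, OplaxLeftLinear.δₗ_associativity_assoc]
  μₗ_unitality n := by
    apply e.hom_ext_of_map_counit
    simp only [Functor.map_comp, Category.assoc, map_inverse_map_counit,
      map_inverseμₗ_counit_assoc]
    rw [← OplaxLeftLinear.δₗ_unitality_hom_assoc, actionUnitIso_hom_naturality]
    rfl

variable (C) in
/-- The inverse of an equivalence whose functor is a module functor is a module functor. -/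
@[reducible]
noncomputable def inverseLeftLinear : e.inverse.LeftLinear C :=
  letI := inverseLaxLeftLinear C e
  leftLinearOfIsIso e.inverse fun c n =>
    inferInstanceAs (IsIso (e.unit.app _ ≫ e.inverse.map
      (OplaxLeftLinear.δₗ e.functor c (e.inverse.obj n) ≫ c ⊴ₗ e.counit.app n)))

/-- An equivalence of linear categories whose functor is a linear module functor is an
equivalence of module categories. -/
noncomputable def toLeftModuleEquivalence (k : Type w) [Field k] [Preadditive M] [Linear k M]
    [Preadditive N] [Linear k N] [e.functor.Additive] [e.functor.Linear k] :
    LeftModuleEquivalence k C M N :=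
  letI := inverseLeftLinear C e
  have hμ : ∀ (c : C) (n : N), LaxLeftLinear.μₗ e.inverse c n = inverseμₗ e c n :=
    fun _ _ => rfl
  { toEquivalence := e
    functor_additive := inferInstance
    functor_linear := inferInstance
    inverse_additive := e.inverse_additive
    inverse_linear := inferInstance
    functor_leftLinear := inferInstance
    inverse_leftLinear := inferInstance
    unit_module := fun c m => by
      -- Trading `δₗ` of the inverse for its inverse `μₗ` and transposing along the counit leaves
      -- only naturality and a triangle identity.
      rw [← cancel_mono (LaxLeftLinear.μₗ e.inverse c (e.functor.obj m)), Category.assoc,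
        Category.assoc, LeftLinear.δₗ_comp_μₗ, Category.comp_id, hμ]
      apply e.hom_ext_of_map_counit
      have h : c ⊴ₗ e.functor.map (e.unit.app m) ≫ c ⊴ₗ e.counit.app (e.functor.obj m) = 𝟙 _ := by
        rw [← actionHomRight_comp]
        exact (congrArg (c ⊴ₗ ·) (e.functor_unit_comp m)).trans (actionHomRight_id _ _)
      have h' := OplaxLeftLinear.δₗ_naturality_right_assoc e.functor c (e.unit.app m)
        (c ⊴ₗ e.counit.app (e.functor.obj m))
      rw [h, Category.comp_id] at h'
      simp only [Functor.map_comp, Category.assoc, map_inverse_map_counit, map_inverseμₗ_counit]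
      exact h'.trans (e.functor_unit_comp_assoc _ _).symm
    counit_module := fun c n => by
      rw [← map_inverseμₗ_counit, ← hμ, ← Functor.map_comp_assoc, LeftLinear.δₗ_comp_μₗ]
      simp }

end Equivalence

end LeftLinear

/-! ### The comparison functor as a linear module functor. -/

namespace MonoidalCategory.InternalHom

variable {C : Type u₁} [Category.{v₁} C] [MonoidalCategory C]
  {M : Type u₂} [Category.{v₂} M] [MonoidalLeftAction C M]
  {m : M} {U : M ⥤ C} (adj : actionRight C m ⊣ U)

/-- The functor to modules over the algebra of internal endomorphisms is a lax module functor. -/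
@[reducible]
def laxLeftLinear :
    letI := monObj adj
    (toModules adj).LaxLeftLinear C :=
  letI := monObj adj
  { μₗ := fun c n => ⟨lin adj c n, by
      have h := lin_act adj c n
      rw [← Category.assoc] at h
      exact h.symm⟩
    μₗ_naturality_left := fun f n => RightModObj.hom_ext (lin_naturality_left adj f n)
    μₗ_naturality_right := fun c _ _ f => RightModObj.hom_ext (lin_naturality_right adj c f)
    μₗ_associativity := fun c c' n => RightModObj.hom_ext (lin_associativity adj c c' n)
    μₗ_unitality := fun n => RightModObj.hom_ext (lin_unitality adj n).symm }

/-- The functor to modules over the algebra of internal endomorphisms is a module functor. -/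
@[reducible]
noncomputable def leftLinear [RigidCategory C] :
    letI := monObj adj
    (toModules adj).LeftLinear C :=
  letI := monObj adj
  letI := laxLeftLinear adj
  leftLinearOfIsIso (toModules adj) fun c n =>
    have : IsIso (LaxLeftLinear.μₗ (toModules adj) c n).hom := isIso_lin adj c n
    RightModObj.isIso_of_isIso_hom _

theorem additive_toModules [Preadditive C] [MonoidalPreadditive C] [Preadditive M] [U.Additive] :
    letI := monObj adj
    (toModules adj).Additive :=
  letI := monObj adj
  { map_add := RightModObj.hom_ext U.map_add }

theorem linear_toModules (k : Type w) [Field k] [Preadditive C] [MonoidalPreadditive C]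
    [Linear k C] [MonoidalLinear k C] [Preadditive M] [Linear k M] [U.Linear k] :
    letI := monObj adj
    (toModules adj).Linear k :=
  letI := monObj adj
  { map_smul := fun f r => RightModObj.hom_ext (U.map_smul r f) }

end MonoidalCategory.InternalHom

end CategoryTheory

/-! ### Exactness, faithfulness and linearity of the internal Hom; conclusion. -/

namespace CategoryTheory

open MonoidalLeftAction MonoidalCategory.InternalHom

variable {C : Type u₁} [Category.{v₁} C] [MonoidalCategory C]
  {M : Type u₂} [Category.{v₂} M] [MonoidalLeftAction C M] {m : M} {U : M ⥤ C}

/-- The internal Hom out of a projective object preserves epimorphisms. -/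
theorem preservesEpimorphisms_of_projective [Abelian C] [RigidCategory C] {P : C} [Projective P]
    (hP : DetectsZero P) [Projective m] (adj : actionRight C m ⊣ U) :
    U.PreservesEpimorphisms where
  preserves {n n'} f _ := by
    refine hP.epi _ fun g => ?_
    have := projective_actionObj P m
    -- Lifting `P ⟶ U n'` along `U.map f` amounts, by transposition, to lifting `P ⊙ₗ m ⟶ n'` along
    -- `f`, which is possible as `P ⊙ₗ m` is projective.
    refine ⟨curry adj (Projective.factorThru (g ⊵ₗ m ≫ ev adj n') f), hom_ext adj ?_⟩
    simp

/-- The internal Hom out of a projective object that detects zero objects is faithful. -/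
theorem faithful_of_detectsZero [Abelian M] [Projective m] (hm : DetectsZero m)
    (adj : actionRight C m ⊣ U) : U.Faithful where
  map_injective {n n'} f g hfg := by
    rw [← sub_eq_zero]
    refine hm.eq_zero _ fun h => ?_
    rw [Preadditive.comp_sub, sub_eq_zero, ← cancel_epi (λₗ[C] m).hom]
    -- A map `m ⟶ n` is the same as a map `𝟙_ C ⟶ U n`, so `U` determines postcomposition on maps
    -- out of `m`.
    have e : curry adj ((λₗ[C] m).hom ≫ h) ≫ U.map f = curry adj ((λₗ[C] m).hom ≫ h) ≫ U.map g := by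
      rw [hfg]
    simpa using congrArg (fun x => x ⊵ₗ m ≫ ev adj n') e

section

variable [Preadditive C] [Preadditive M]

theorem additive_actionRight (k : Type w) [Field k] [Linear k C] [Linear k M]
    [IsBilinearAction k C M] (m : M) : (actionRight C m).Additive where
  map_add {_ _ f g} := IsBilinearAction.add_actionHomLeft k f g m

theorem linear_actionRight (k : Type w) [Field k] [Linear k C] [Linear k M]
    [IsBilinearAction k C M] (m : M) : (actionRight C m).Linear k where
  map_smul f r := IsBilinearAction.smul_actionHomLeft r f m

theorem linear_internalHom (k : Type w) [Field k] [Linear k C] [Linear k M]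
    [IsBilinearAction k C M] (adj : actionRight C m ⊣ U) : U.Linear k where
  map_smul f r := hom_ext adj (by
    rw [map_ev, IsBilinearAction.smul_actionHomLeft, Linear.smul_comp, map_ev, Linear.comp_smul])

end

end CategoryTheory

theorem theorem2p11
    (k : Type w) [Field k]
    (C : Type u₁) [Category.{v₁} C] [Abelian C] [Linear k C] [IsFiniteLinearCategory k C]
    [MonoidalCategory C] [MonoidalPreadditive C] [MonoidalLinear k C] [RigidCategory C]
    (M : Type u₂) [Category.{v₂} M] [Abelian M] [Linear k M] [IsFiniteLinearCategory k M]
    [MonoidalLeftAction C M] [IsBilinearAction k C M]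
    (hM : ActionRightExactLeft C M) :
    ∃ A : Mon C, Nonempty (LeftModuleEquivalence k C M (RightModObj A.X)) := by
  obtain ⟨P, _, hP⟩ := exists_projective_detectsZero k C
  obtain ⟨m, _, hm⟩ := exists_projective_detectsZero k M
  have := hM m
  have := additive_actionRight k (C := C) m
  have := linear_actionRight k (C := C) m
  have : (MonoidalLeftAction.actionRight C m).IsLeftAdjoint :=
    isLeftAdjoint_of_preservesFiniteColimits (k := k) hP
      (IsFiniteLinearCategory.finite_hom P) IsFiniteLinearCategory.finite_hom _
  obtain ⟨U, ⟨adj⟩⟩ := this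
  have := adj.right_adjoint_additive
  have := linear_internalHom k adj
  have := preservesEpimorphisms_of_projective hP adj
  -- A right adjoint preserves kernels; with preservation of epimorphisms this makes `U` exact.
  have := adj.rightAdjoint_preservesLimits
  have : U.PreservesHomology := U.preservesHomology_of_preservesEpis_and_kernels
  have : Limits.PreservesFiniteColimits U := U.preservesFiniteColimits_of_preservesHomology
  have : U.Faithful := faithful_of_detectsZero hm adj
  let := InternalHom.monObj adj
  have := InternalHom.isEquivalence_toModules adj
  let e : M ≌ RightModObj (U.obj m) := (InternalHom.toModules adj).asEquivalence
  let : e.functor.LeftLinear C := InternalHom.leftLinear adj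
  have : e.functor.Additive := InternalHom.additive_toModules adj
  have : e.functor.Linear k := InternalHom.linear_toModules adj k
  exact ⟨⟨U.obj m⟩, ⟨e.toLeftModuleEquivalence k⟩⟩
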